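/- Let $V=\mathbb{C}^2$ with basis $(e_1,e_2)$ and identify a bilinear product on $V$, $e_i\cdot e_j=\sum_k c_{ij}^k e_k$, with its structure constants $(c_{ij}^k)\in\mathbb{C}^8$. Let $\mathcal{P}_2(\mathbb{C})\subset\mathbb{C}^8$ be the set of pre-Lie structures, i.e. those with $(x\cdot y)\cdot z-x\cdot(y\cdot z)=(y\cdot x)\cdot z-y\cdot(x\cdot z)$ for all $x,y,z$, and let $\mathcal{N}_2(\mathbb{C})\subset\mathcal{P}_2(\mathbb{C})$ be the set of Novikov structures, i.e. those with in addition $(x\cdot y)\cdot z=(x\cdot z)\cdot y$ for all $x,y,z$. The group $GL_2(\mathbb{C})$ acts by $(g\circ\mu)(x,y)=g(\mu(g^{-1}x,g^{-1}y))$; $O(\mu)$ is the orbit and $\overline{O(\mu)}$ its Zariski closure. For $\lambda,\mu\in\mathcal{P}_2(\mathbb{C})$, say that $\lambda$ degenerates properly to $\mu$ if $\mu\in\overline{O(\lambda)}\setminus O(\lambda)$. Consider the following products (products of basis vectors that are not listed are $0$): - $A_1$: zero product; - $A_2$: $e_1\cdot e_1=e_1$; - $A_3$: $e_1\cdot e_1=e_1$,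 $e_2\cdot e_2=e_2$; - $A_4$: $e_1\cdot e_2=e_1$, $e_2\cdot e_1=e_1$, $e_2\cdot e_2=e_2$; - $A_5$: $e_2\cdot e_2=e_1$; - $B_2(\beta)$, $\beta\in\mathbb{C}$: $e_1\cdot e_2=\beta e_1$, $e_2\cdot e_1=(\beta-1)e_1$, $e_2\cdot e_2=\beta e_2$; - $B_5$: $e_1\cdot e_2=e_1$, $e_2\cdot e_2=e_1+e_2$. These are all Novikov structures, and every structure in $\mathcal{N}_2(\mathbb{C})$ lies in the orbit of exactly one of them. The closure of the orbit of each of them, taken in $\mathcal{N}_2(\mathbb{C})$ or in $\mathcal{P}_2(\mathbb{C})$, is the union of its own orbit and of the orbits of the following algebras, which are therefore exactly the listed algebras to which it degenerates properly: - $A_3$: $A_2,A_4,A_5,A_1$; - $A_2$: $A_5,A_1$; - $A_4$: $A_5,A_1$; - $B_2(\beta)$ with $\beta\neq1$: $A_5,A_1$; - $B_5$: $A_5,B_2(1),A_1$; - $A_5$: $A_1$; - $B_2(1)$: $A_1$; - $A_1$: none. The Hasse diagram of degenerations of two-dimensional complex Novikov algebras has the arrows $$A_3\to A_2,\quad A_3\to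 A_4,\quad A_2\to A_5,\quad A_4\to A_5,\quad B_2(\beta)\to A_5\ (\beta\ne1),\quad B_5\to A_5,\quad B_5\to B_2(1),\quad A_5\to A_1,\quad B_2(1)\to A_1,$$ and these are exactly the proper degenerations between listed algebras with no listed algebra strictly in between. The rows of the diagram, from top to bottom, are given by the dimension of the derivation algebra: $\dim\mathrm{Der}=0$ for $A_3$; $\dim\mathrm{Der}=1$ for $A_2$, $A_4$, $B_2(\beta)$ with $\beta\neq1$, and $B_5$; $\dim\mathrm{Der}=2$ for $A_5$ and $B_2(1)$; $\dim\mathrm{Der}=4$ for $A_1$. -/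

import Mathlib

namespace NovikovDegeneration

/-- Structure constants `c (i, j, k)` (the coefficient of `e_k` in `e_i · e_j`) of an algebra
product on `K ^ n`: the points of the affine space `K ^ (n ^ 3)`. -/
abbrev StructureConstants (K : Type*) (n : ℕ) : Type _ :=
  Fin n × Fin n × Fin n → K

/-- The bilinear product on `K ^ n` with `e_i · e_j = ∑ k, c (i, j, k) e_k`. -/
def product {K : Type*} [Field K] {n : ℕ} (c : StructureConstants K n) :
    (Fin n → K) →ₗ[K] (Fin n → K) →ₗ[K] (Fin n → K) :=
  LinearMap.mk₂ K (fun x y k => ∑ i, ∑ j, c (i, j, k) * (x i * y j))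
    (fun x x' y => by
      funext k
      simp only [Pi.add_apply, add_mul, mul_add, Finset.sum_add_distrib])
    (fun a x y => by
      funext k
      simp only [Pi.smul_apply, smul_eq_mul, Finset.mul_sum]
      exact Finset.sum_congr rfl fun i _ => Finset.sum_congr rfl fun j _ => by ring)
    (fun x y y' => by
      funext k
      simp only [Pi.add_apply, mul_add, Finset.sum_add_distrib])
    (fun a x y => by
      funext k
      simp only [Pi.smul_apply, smul_eq_mul, Finset.mul_sum]
      exact Finset.sum_congr rfl fun i _ => Finset.sum_congr rfl fun j _ => by ring)

/-- The variety of pre-Lie (left-symmetric) algebra structures on `K ^ n`. -/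
def preLieVariety (K : Type*) [Field K] (n : ℕ) : Set (StructureConstants K n) :=
  {c | ∀ x y z : Fin n → K,
    product c (product c x y) z - product c x (product c y z) =
      product c (product c y x) z - product c y (product c x z)}

/-- The variety of Novikov algebra structures on `K ^ n`: pre-Lie structures in which
`(x · y) · z = (x · z) · y`. -/
def novikovVariety (K : Type*) [Field K] (n : ℕ) : Set (StructureConstants K n) :=
  {c | c ∈ preLieVariety K n ∧ ∀ x y z : Fin n → K,
    product c (product c x y) z = product c (product c x z) y}

/-- The orbit of `c` under `GL_n(K)` acting on products by
`(g ∘ μ)(x, y) = g (μ (g⁻¹ x, g⁻¹ y))`. -/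
def orbit {K : Type*} [Field K] {n : ℕ} (c : StructureConstants K n) :
    Set (StructureConstants K n) :=
  {d | ∃ g : Matrix.GeneralLinearGroup (Fin n) K, ∀ x y : Fin n → K,
    product d x y =
      (g : Matrix (Fin n) (Fin n) K).mulVec
        (product c ((g⁻¹ : Matrix.GeneralLinearGroup (Fin n) K).val.mulVec x)
          ((g⁻¹ : Matrix.GeneralLinearGroup (Fin n) K).val.mulVec y))}

/-- Zariski closure of a set of structure constants in affine space: the common zeros of all
polynomials that vanish on the set. -/
def zariskiClosure {K : Type*} [Field K] {n : ℕ} (S : Set (StructureConstants K n)) :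
    Set (StructureConstants K n) :=
  MvPolynomial.zeroLocus K (MvPolynomial.vanishingIdeal K S)

/-- The closure of the orbit of `c` in the set `X` of structures, for the Zariski topology that
`X` inherits from affine space. -/
def orbitClosureIn {K : Type*} [Field K] {n : ℕ} (X : Set (StructureConstants K n))
    (c : StructureConstants K n) : Set (StructureConstants K n) :=
  X ∩ zariskiClosure (orbit c)

/-- `c` degenerates properly to `d` in the variety of pre-Lie algebra structures. -/
def ProperlyDegenerates {K : Type*} [Field K] {n : ℕ} (c d : StructureConstants K n) : Prop :=
  d ∈ orbitClosureIn (preLieVariety K n) c \ orbit c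

/-- The space of derivations of the algebra with structure constants `c`. -/
def derivations {K : Type*} [Field K] {n : ℕ} (c : StructureConstants K n) :
    Submodule K (Module.End K (Fin n → K)) where
  carrier := {D | ∀ x y, D (product c x y) = product c (D x) y + product c x (D y)}
  zero_mem' := by intro x y; simp
  add_mem' := by
    intro D E hD hE x y
    simp only [LinearMap.add_apply, map_add, hD x y, hE x y]
    abel
  smul_mem' := by
    intro a D hD x y
    simp only [LinearMap.smul_apply, map_smul, hD x y, smul_add]

/-- The structure constants on `ℂ ^ 2` with prescribed products
`e₁ · e₁`, `e₁ · e₂`, `e₂ · e₁`, `e₂ · e₂`, in this order. -/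
def ofProducts (p₁₁ p₁₂ p₂₁ p₂₂ : Fin 2 → ℂ) : StructureConstants ℂ 2 :=
  fun s => (![![p₁₁, p₁₂], ![p₂₁, p₂₂]] s.1 s.2.1) s.2.2

/-- Names of the two-dimensional complex Novikov algebras. -/
inductive Label : Type
  | A1 : Label
  | A2 : Label
  | A3 : Label
  | A4 : Label
  | A5 : Label
  | B2 (β : ℂ) : Label
  | B5 : Label

/-- The algebras in the list, in the basis `e₁ = ![1, 0]`, `e₂ = ![0, 1]`. -/
def law : Label → StructureConstants ℂ 2
  | .A1 => ofProducts 0 0 0 0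
  | .A2 => ofProducts ![1, 0] 0 0 0
  | .A3 => ofProducts ![1, 0] 0 0 ![0, 1]
  | .A4 => ofProducts 0 ![1, 0] ![1, 0] ![0, 1]
  | .A5 => ofProducts 0 0 0 ![1, 0]
  | .B2 β => ofProducts 0 ![β, 0] ![β - 1, 0] ![0, β]
  | .B5 => ofProducts 0 ![1, 0] 0 ![1, 1]

/-- The table of orbit closures (the algebra itself is not listed). -/
def closureTable : Label → Set Label
  | .A1 => ∅
  | .A2 => {.A5, .A1}
  | .A3 => {.A2, .A4, .A5, .A1}
  | .A4 => {.A5, .A1}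
  | .A5 => {.A1}
  | .B2 β => {S | (β ≠ 1 ∧ S = .A5) ∨ S = .A1}
  | .B5 => {.A5, .B2 1, .A1}

/-- The arrows of the Hasse diagram. -/
inductive HasseArrow : Label → Label → Prop
  | A3_A2 : HasseArrow .A3 .A2
  | A3_A4 : HasseArrow .A3 .A4
  | A2_A5 : HasseArrow .A2 .A5
  | A4_A5 : HasseArrow .A4 .A5
  | B2_A5 (β : ℂ) (hβ : β ≠ 1) : HasseArrow (.B2 β) .A5
  | B5_A5 : HasseArrow .B5 .A5
  | B5_B2 : HasseArrow .B5 (.B2 1)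
  | A5_A1 : HasseArrow .A5 .A1
  | B2_A1 : HasseArrow (.B2 1) .A1

end NovikovDegeneration

/-!
The orbit of an algebra under `GL_n` is its isomorphism class (`mem_orbit_iff`), so everything
reduces to three facts about isomorphism classes.

*Classification* (`exists_label`). In a noncommutative Novikov plane the commutators span a line,
and in a basis with `[e₁, e₂] = e₁` the Novikov identities leave a two-parameter family, which is
normalized by hand to `B₂(β)` or `B₅`. A commutative Novikov algebra is associative. If some `x` is
not proportional to `x · x`, it generates the algebra, which is then `t ℂ[t] / (t (t - u) (t - v))`,
and the coincidences among `0`, `u`, `v` give `A₂`, `A₃`, `A₄`, `A₅`. Otherwise the product is zero.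

*Upper bounds for closures*. An `IsClosedInvariant` set that contains an algebra contains the
Zariski closure of its orbit. The Novikov variety is such a set, so the closure of the orbit of a
listed algebra is a union of orbits of listed algebras, whether it is taken among Novikov or
among pre-Lie structures. The sets `closedBound`, given by commutativity and by relations between
traces and determinants of left and right multiplications, exclude all algebras that are not in
`closureTable` (`mem_closureTable_of_law_mem_closedBound`). Since the table is antisymmetric, they
also show that distinct labels have distinct orbits (`label_unique`).

*Degenerations*. Zariski closures contain limits in the usual topology, so a family of bases
of `law T` in which the structure constants tend to those of `law S` puts the orbit of `law S` into
the closure (`orbit_subset_zariskiClosure_of_mem_closureTable`).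

The Hasse diagram is then read off from the table, and derivations are computed from Leibniz's rule
on the basis (`mem_derivations_iff`).
-/

namespace NovikovDegeneration

/-! ### Orbits as isomorphism classes -/

section Orbits

variable {K : Type*} [Field K] {n : ℕ}

theorem product_single (c : StructureConstants K n) (i j k : Fin n) :
    product c (Pi.single i 1) (Pi.single j 1) k = c (i, j, k) := by
  change ∑ a, ∑ b, c (a, b, k) * ((Pi.single i 1 : Fin n → K) a * (Pi.single j 1 : Fin n → K) b) = _
  simp [Pi.single_apply]

theorem product_injective :
    Function.Injective (product : StructureConstants K n → _) := by
  intro c d h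
  funext ⟨i, j, k⟩
  rw [← product_single c, ← product_single d, h]

/-- The structure constants of a bilinear product, in the standard basis. -/
def ofBilinear (B : (Fin n → K) →ₗ[K] (Fin n → K) →ₗ[K] (Fin n → K)) : StructureConstants K n :=
  fun s => B (Pi.single s.1 1) (Pi.single s.2.1 1) s.2.2

theorem product_ofBilinear (B : (Fin n → K) →ₗ[K] (Fin n → K) →ₗ[K] (Fin n → K)) :
    product (ofBilinear B) = B := by
  refine LinearMap.ext_basis (Pi.basisFun K (Fin n)) (Pi.basisFun K (Fin n)) fun i j => ?_
  funext k
  simp only [Pi.basisFun_apply, product_single]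
  rfl

/-- The orbit of `c` is its isomorphism class. -/
theorem mem_orbit_iff {c d : StructureConstants K n} :
    d ∈ orbit c ↔ ∃ e : (Fin n → K) ≃ₗ[K] (Fin n → K),
      ∀ x y, e (product c x y) = product d (e x) (e y) := by
  constructor
  · rintro ⟨g, hg⟩
    refine ⟨LinearMap.GeneralLinearGroup.generalLinearEquiv K _
      (Matrix.GeneralLinearGroup.toLin g), fun x y => ?_⟩
    have h (z : Fin n → K) : LinearMap.GeneralLinearGroup.generalLinearEquiv K _
      (Matrix.GeneralLinearGroup.toLin g) z = g.val.mulVec z := rfl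
    have h' (z : Fin n → K) : (g⁻¹).val.mulVec (g.val.mulVec z) = z := by
      rw [Matrix.mulVec_mulVec, ← Units.val_mul, inv_mul_cancel, Units.val_one, Matrix.one_mulVec]
    rw [h, h, h, hg, h', h']
  · rintro ⟨e, he⟩
    refine ⟨Matrix.GeneralLinearGroup.toLin.symm
      ((LinearMap.GeneralLinearGroup.generalLinearEquiv K _).symm e), fun x y => ?_⟩
    have h (f : (Fin n → K) ≃ₗ[K] (Fin n → K)) (z : Fin n → K) :
        (Matrix.GeneralLinearGroup.toLin.symm
          ((LinearMap.GeneralLinearGroup.generalLinearEquiv K _).symm f)).val.mulVec z = f z := by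
      change (LinearMap.toMatrix' (f : (Fin n → K) →ₗ[K] (Fin n → K))).mulVec z = f z
      rw [LinearMap.toMatrix'_mulVec]; rfl
    rw [← map_inv, ← map_inv, h, h, h, he]
    change _ = product d (e (e.symm x)) (e (e.symm y))
    simp

theorem mem_orbit_self (c : StructureConstants K n) : c ∈ orbit c :=
  mem_orbit_iff.2 ⟨LinearEquiv.refl K _, fun _ _ => rfl⟩

theorem mem_orbit_symm {c d : StructureConstants K n} (h : d ∈ orbit c) : c ∈ orbit d := by
  obtain ⟨e, he⟩ := mem_orbit_iff.1 h
  refine mem_orbit_iff.2 ⟨e.symm, fun x y => ?_⟩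
  rw [LinearEquiv.symm_apply_eq, he]
  simp

theorem mem_orbit_trans {b c d : StructureConstants K n} (h₁ : c ∈ orbit b) (h₂ : d ∈ orbit c) :
    d ∈ orbit b := by
  obtain ⟨e, he⟩ := mem_orbit_iff.1 h₁
  obtain ⟨f, hf⟩ := mem_orbit_iff.1 h₂
  exact mem_orbit_iff.2 ⟨e.trans f, fun x y => by simp [he, hf]⟩

/-- The structure constants obtained from `c` by transport along a linear automorphism `e`. -/
def transport (e : (Fin n → K) ≃ₗ[K] (Fin n → K)) (c : StructureConstants K n) :
    StructureConstants K n :=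
  ofBilinear (((product c).compl₁₂ e.symm.toLinearMap e.symm.toLinearMap).compr₂ e.toLinearMap)

theorem product_transport (e : (Fin n → K) ≃ₗ[K] (Fin n → K)) (c : StructureConstants K n)
    (x y : Fin n → K) :
    product (transport e c) x y = e (product c (e.symm x) (e.symm y)) := by
  rw [transport, product_ofBilinear]; rfl

theorem transport_mem_orbit (e : (Fin n → K) ≃ₗ[K] (Fin n → K)) (c : StructureConstants K n) :
    transport e c ∈ orbit c :=
  mem_orbit_iff.2 ⟨e, fun x y => by simp [product_transport]⟩

/-! ### Closed invariant conditions -/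

/-- The algebra of polynomial functions of the structure constants. -/
noncomputable def polynomialFunctions (K : Type*) [Field K] (n : ℕ) :
    Subalgebra K (StructureConstants K n → K) :=
  (MvPolynomial.aeval (fun s (c : StructureConstants K n) => c s) :
    MvPolynomial (Fin n × Fin n × Fin n) K →ₐ[K] (StructureConstants K n → K)).range

theorem exists_aeval_eq {F : StructureConstants K n → K} (hF : F ∈ polynomialFunctions K n) :
    ∃ p : MvPolynomial (Fin n × Fin n × Fin n) K, ∀ c, MvPolynomial.aeval c p = F c := by
  obtain ⟨p, rfl⟩ := hF
  refine ⟨p, fun c => ?_⟩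
  have := (MvPolynomial.comp_aeval_apply (R := K) (fun s (c : StructureConstants K n) => c s)
    (Pi.evalAlgHom K (fun _ : StructureConstants K n => K) c) p)
  exact this.symm

theorem coord_mem_polynomialFunctions (s : Fin n × Fin n × Fin n) :
    (fun c : StructureConstants K n => c s) ∈ polynomialFunctions K n :=
  ⟨MvPolynomial.X s, by simp⟩

theorem const_mem_polynomialFunctions (a : K) :
    (fun _ : StructureConstants K n => a) ∈ polynomialFunctions K n :=
  (polynomialFunctions K n).algebraMap_mem a

/-- A product of two vectors that depend polynomially on the structure constants depends
polynomially on the structure constants. -/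
theorem product_mem_polynomialFunctions {x y : StructureConstants K n → Fin n → K}
    (hx : ∀ i, (fun c => x c i) ∈ polynomialFunctions K n)
    (hy : ∀ i, (fun c => y c i) ∈ polynomialFunctions K n) (k : Fin n) :
    (fun c => product c (x c) (y c) k) ∈ polynomialFunctions K n := by
  have h : (fun c => product c (x c) (y c) k) =
      ∑ i, ∑ j, (fun c : StructureConstants K n => c (i, j, k)) *
        ((fun c => x c i) * (fun c => y c j)) := by
    funext c
    simp [product]
  rw [h]
  exact sum_mem fun i _ => sum_mem fun j _ =>
    mul_mem (coord_mem_polynomialFunctions _) (mul_mem (hx i) (hy j))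

theorem product_const_mem_polynomialFunctions (x y : Fin n → K) (k : Fin n) :
    (fun c : StructureConstants K n => product c x y k) ∈ polynomialFunctions K n :=
  product_mem_polynomialFunctions (x := fun _ => x) (y := fun _ => y)
    (fun i => const_mem_polynomialFunctions (x i)) (fun i => const_mem_polynomialFunctions (y i)) k

/-- A `GL_n`-invariant Zariski closed set of structure constants. -/
structure IsClosedInvariant (Z : Set (StructureConstants K n)) : Prop where
  orbit_subset : ∀ c ∈ Z, orbit c ⊆ Z
  closure_subset : zariskiClosure Z ⊆ Z

theorem zariskiClosure_mono {S T : Set (StructureConstants K n)} (h : S ⊆ T) :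
    zariskiClosure S ⊆ zariskiClosure T :=
  fun _ hc p hp => hc p fun d hd => hp d (h hd)

theorem IsClosedInvariant.zariskiClosure_orbit_subset {Z : Set (StructureConstants K n)}
    (hZ : IsClosedInvariant Z) {c : StructureConstants K n} (hc : c ∈ Z) :
    zariskiClosure (orbit c) ⊆ Z :=
  (zariskiClosure_mono (hZ.orbit_subset c hc)).trans hZ.closure_subset

theorem IsClosedInvariant.inter {Y Z : Set (StructureConstants K n)}
    (hY : IsClosedInvariant Y) (hZ : IsClosedInvariant Z) : IsClosedInvariant (Y ∩ Z) where
  orbit_subset c hc := Set.subset_inter (hY.orbit_subset c hc.1) (hZ.orbit_subset c hc.2)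
  closure_subset := Set.subset_inter
    ((zariskiClosure_mono Set.inter_subset_left).trans hY.closure_subset)
    ((zariskiClosure_mono Set.inter_subset_right).trans hZ.closure_subset)

/-- A set cut out by polynomial equations is Zariski closed. -/
theorem zariskiClosure_subset_of_equations {ι : Sort*} {Z : Set (StructureConstants K n)}
    (F : ι → StructureConstants K n → K) (hF : ∀ i, F i ∈ polynomialFunctions K n)
    (hZ : ∀ c, c ∈ Z ↔ ∀ i, F i c = 0) : zariskiClosure Z ⊆ Z := by
  intro c hc
  refine (hZ c).2 fun i => ?_
  obtain ⟨p, hp⟩ := exists_aeval_eq (hF i)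
  rw [← hp]
  exact hc p fun d hd => (hp d).trans ((hZ d).1 hd i)

/-- An identity in three variables, given by a vector-valued expression that is polynomial in the
structure constants and compatible with isomorphisms, defines a closed invariant set. -/
theorem isClosedInvariant_of_identity
    (W : StructureConstants K n → (Fin n → K) → (Fin n → K) → (Fin n → K) → (Fin n → K))
    (hpoly : ∀ x y z k, (fun c => W c x y z k) ∈ polynomialFunctions K n)
    (hequiv : ∀ (c d : StructureConstants K n) (e : (Fin n → K) ≃ₗ[K] (Fin n → K)),
      (∀ x y, e (product c x y) = product d (e x) (e y)) →
        ∀ x y z, W d (e x) (e y) (e z) = e (W c x y z)) :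
    IsClosedInvariant {c | ∀ x y z, W c x y z = 0} where
  orbit_subset c hc d hd x y z := by
    obtain ⟨e, he⟩ := mem_orbit_iff.1 hd
    have := hequiv c d e he (e.symm x) (e.symm y) (e.symm z)
    simpa [hc _ _ _] using this
  closure_subset := by
    refine zariskiClosure_subset_of_equations
      (ι := (Fin n → K) × (Fin n → K) × (Fin n → K) × Fin n)
      (fun s c => W c s.1 s.2.1 s.2.2.1 s.2.2.2) (fun s => hpoly _ _ _ _) fun c => ?_
    simp [Prod.forall, funext_iff]

theorem isClosedInvariant_novikovVariety : IsClosedInvariant (novikovVariety K n) := by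
  have h₁ : IsClosedInvariant (preLieVariety K n) := by
    have := isClosedInvariant_of_identity (K := K) (n := n) (fun c x y z =>
      (product c (product c x y) z - product c x (product c y z)) -
        (product c (product c y x) z - product c y (product c x z))) ?_ ?_
    · simpa only [preLieVariety, sub_eq_zero] using this
    · intro x y z k
      have hc (v : Fin n → K) (i : Fin n) := const_mem_polynomialFunctions (n := n) (v i)
      have hp (u v : Fin n → K) := product_const_mem_polynomialFunctions u v
      exact sub_mem (sub_mem (product_mem_polynomialFunctions (hp x y) (hc z) k)
        (product_mem_polynomialFunctions (hc x) (hp y z) k))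
        (sub_mem (product_mem_polynomialFunctions (hp y x) (hc z) k)
        (product_mem_polynomialFunctions (hc y) (hp x z) k))
    · intro c d e he x y z
      simp only [← he, ← map_sub]
  have h₂ : IsClosedInvariant {c : StructureConstants K n | ∀ x y z : Fin n → K,
      product c (product c x y) z = product c (product c x z) y} := by
    have := isClosedInvariant_of_identity (K := K) (n := n) (fun c x y z =>
      product c (product c x y) z - product c (product c x z) y) ?_ ?_
    · simpa only [sub_eq_zero] using this
    · intro x y z k
      have hc (v : Fin n → K) (i : Fin n) := const_mem_polynomialFunctions (n := n) (v i)
      have hp (u v : Fin n → K) := product_const_mem_polynomialFunctions u v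
      exact sub_mem (product_mem_polynomialFunctions (hp x y) (hc z) k)
        (product_mem_polynomialFunctions (hp x z) (hc y) k)
    · intro c d e he x y z
      simp only [← he, ← map_sub]
  exact h₁.inter h₂

theorem isClosedInvariant_commutative :
    IsClosedInvariant {c : StructureConstants K n | ∀ x y, product c x y = product c y x} := by
  have := isClosedInvariant_of_identity (K := K) (n := n) (fun c x y _ =>
    product c x y - product c y x) ?_ ?_
  · simpa [sub_eq_zero] using this
  · intro x y z k
    exact sub_mem (product_const_mem_polynomialFunctions x y k)
      (product_const_mem_polynomialFunctions y x k)
  · intro c d e he x y z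
    simp only [← he, ← map_sub]

/-- If the scalar expression `F c x` is polynomial in the structure constants `c` and depends only
on the conjugacy classes of the left and right multiplications by `x`, then its vanishing for all
`x` is a closed invariant condition. -/
theorem isClosedInvariant_of_conj (F : StructureConstants K n → (Fin n → K) → K)
    (hpoly : ∀ x, (fun c => F c x) ∈ polynomialFunctions K n)
    (hinv : ∀ (c d : StructureConstants K n) (e : (Fin n → K) ≃ₗ[K] (Fin n → K)) (x : Fin n → K),
      product d (e x) = e.conj (product c x) →
        (product d).flip (e x) = e.conj ((product c).flip x) → F d (e x) = F c x) :
    IsClosedInvariant {c | ∀ x, F c x = 0} where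
  orbit_subset c hc d hd x := by
    obtain ⟨e, he⟩ := mem_orbit_iff.1 hd
    rw [← e.apply_symm_apply x, hinv c d e, hc]
    · refine LinearMap.ext fun y => ?_
      simp [LinearEquiv.conj_apply, he]
    · refine LinearMap.ext fun y => ?_
      simp [LinearEquiv.conj_apply, he]
  closure_subset := zariskiClosure_subset_of_equations (fun x c => F c x) hpoly fun _ => Iff.rfl

theorem trace_eq_sum (f : Module.End K (Fin n → K)) :
    LinearMap.trace K _ f = ∑ i, f (Pi.single i 1) i := by
  rw [LinearMap.trace_eq_matrix_trace K (Pi.basisFun K (Fin n)), Matrix.trace]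
  simp

theorem trace_left_mem_polynomialFunctions (x : Fin n → K) :
    (fun c => LinearMap.trace K _ (product c x)) ∈ polynomialFunctions K n := by
  have h : (fun c => LinearMap.trace K _ (product c x)) =
      ∑ i, fun c => product c x (Pi.single i 1) i := by
    funext c
    simp [trace_eq_sum]
  rw [h]
  exact sum_mem fun i _ => product_const_mem_polynomialFunctions _ _ i

theorem trace_right_mem_polynomialFunctions (x : Fin n → K) :
    (fun c => LinearMap.trace K _ ((product c).flip x)) ∈ polynomialFunctions K n := by
  have h : (fun c => LinearMap.trace K _ ((product c).flip x)) =
      ∑ i, fun c => product c (Pi.single i 1) x i := by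
    funext c
    simp [trace_eq_sum]
  rw [h]
  exact sum_mem fun i _ => product_const_mem_polynomialFunctions _ _ i

theorem isClosedInvariant_trace_relation (a b : K) :
    IsClosedInvariant {c : StructureConstants K n | ∀ x,
      a * LinearMap.trace K _ (product c x) - b * LinearMap.trace K _ ((product c).flip x) = 0} :=
  isClosedInvariant_of_conj _
    (fun x => sub_mem
      (mul_mem (const_mem_polynomialFunctions a) (trace_left_mem_polynomialFunctions x))
      (mul_mem (const_mem_polynomialFunctions b) (trace_right_mem_polynomialFunctions x)))
    fun c d e x h₁ h₂ => by rw [h₁, h₂, LinearMap.trace_conj', LinearMap.trace_conj']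

/-- The condition that every right multiplication `R_y` satisfies `n R_y = tr(R_y) id`. -/
theorem isClosedInvariant_scalar_right :
    IsClosedInvariant {c : StructureConstants K n | ∀ x y,
      (n : K) • product c x y - LinearMap.trace K _ ((product c).flip y) • x = 0} := by
  have := isClosedInvariant_of_identity (K := K) (n := n) (fun c x y _ =>
    (n : K) • product c x y - LinearMap.trace K _ ((product c).flip y) • x) ?_ ?_
  · simpa using this
  · intro x y z k
    exact sub_mem (mul_mem (const_mem_polynomialFunctions _)
      (product_const_mem_polynomialFunctions x y k))
      (mul_mem (trace_right_mem_polynomialFunctions y) (const_mem_polynomialFunctions (x k)))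
  · intro c d e he x y z
    have h : (product d).flip (e y) = e.conj ((product c).flip y) := by
      refine LinearMap.ext fun z => ?_
      simp [LinearEquiv.conj_apply, he]
    simp only [← he, h, LinearMap.trace_conj', map_sub, map_smul]

end Orbits

/-! ### Determinants of right multiplications in dimension two -/

section Plane

variable {K : Type*} [Field K]

theorem det_eq_of_fin_two (f : Module.End K (Fin 2 → K)) :
    LinearMap.det f = f (Pi.single 0 1) 0 * f (Pi.single 1 1) 1 -
      f (Pi.single 1 1) 0 * f (Pi.single 0 1) 1 := by
  rw [← LinearMap.det_toMatrix', Matrix.det_fin_two]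
  simp [LinearMap.toMatrix'_apply]

/-- For `(a, b) = (1, 0)` the right multiplications are singular; for `(a, b) = (4, 1)` their
characteristic polynomials have discriminant zero. -/
theorem isClosedInvariant_det_relation (a b : K) :
    IsClosedInvariant {c : StructureConstants K 2 | ∀ x,
      a * LinearMap.det ((product c).flip x) -
        b * LinearMap.trace K _ ((product c).flip x) ^ 2 = 0} := by
  refine isClosedInvariant_of_conj _ (fun x => ?_) fun c d e x _ h => ?_
  · have hp (i j : Fin 2) : (fun c => product c (Pi.single i 1) x j) ∈ polynomialFunctions K 2 :=
      product_const_mem_polynomialFunctions _ _ j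
    have hdet : (fun c : StructureConstants K 2 => LinearMap.det ((product c).flip x)) ∈
        polynomialFunctions K 2 := by
      simp only [det_eq_of_fin_two, LinearMap.flip_apply]
      exact sub_mem (mul_mem (hp 0 0) (hp 1 1)) (mul_mem (hp 1 0) (hp 0 1))
    exact sub_mem (mul_mem (const_mem_polynomialFunctions a) hdet)
      (mul_mem (const_mem_polynomialFunctions b)
        (pow_mem (trace_right_mem_polynomialFunctions x) 2))
  · rw [h, LinearMap.trace_conj', LinearEquiv.conj_apply, LinearMap.comp_assoc,
      LinearMap.det_conj]

end Plane

/-! ### Changes of basis in the plane -/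

theorem product_ofProducts (p q r s x y : Fin 2 → ℂ) :
    product (ofProducts p q r s) x y =
      (x 0 * y 0) • p + (x 0 * y 1) • q + (x 1 * y 0) • r + (x 1 * y 1) • s := by
  funext k
  simp [product, ofProducts, Fin.sum_univ_two]
  ring

theorem eq_ofProducts (c : StructureConstants ℂ 2) :
    c = ofProducts ![c (0, 0, 0), c (0, 0, 1)] ![c (0, 1, 0), c (0, 1, 1)]
      ![c (1, 0, 0), c (1, 0, 1)] ![c (1, 1, 0), c (1, 1, 1)] := by
  funext ⟨i, j, k⟩
  fin_cases i <;> fin_cases j <;> fin_cases k <;> rfl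

theorem product_basis (c : StructureConstants ℂ 2) (u v : Fin 2 → ℂ) (x y : Fin 2 → ℂ) :
    product c (x 0 • u + x 1 • v) (y 0 • u + y 1 • v) =
      (x 0 * y 0) • product c u u + (x 0 * y 1) • product c u v +
        (x 1 * y 0) • product c v u + (x 1 * y 1) • product c v v := by
  simp only [map_add, map_smul, LinearMap.add_apply, LinearMap.smul_apply, smul_add, smul_smul,
    mul_comm (y 0), mul_comm (y 1)]
  abel

theorem exists_linearEquiv_of_basis {u v : Fin 2 → ℂ} (h : u 0 * v 1 - u 1 * v 0 ≠ 0) :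
    ∃ e : (Fin 2 → ℂ) ≃ₗ[ℂ] (Fin 2 → ℂ), ∀ x, e x = x 0 • u + x 1 • v := by
  let f : (Fin 2 → ℂ) →ₗ[ℂ] (Fin 2 → ℂ) :=
    (LinearMap.proj 0).smulRight u + (LinearMap.proj 1).smulRight v
  have hf : Function.Injective f := by
    rw [injective_iff_map_eq_zero]
    intro x hx
    have h₀ : x 0 * u 0 + x 1 * v 0 = 0 := congrFun hx 0
    have h₁ : x 0 * u 1 + x 1 * v 1 = 0 := congrFun hx 1
    funext i
    fin_cases i
    · exact (mul_eq_zero.1 (by linear_combination v 1 * h₀ - v 0 * h₁ :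
        x 0 * (u 0 * v 1 - u 1 * v 0) = 0)).resolve_right h
    · exact (mul_eq_zero.1 (by linear_combination u 0 * h₁ - u 1 * h₀ :
        x 1 * (u 0 * v 1 - u 1 * v 0) = 0)).resolve_right h
  exact ⟨LinearEquiv.ofInjectiveEndo f hf, fun x => rfl⟩

/-- If `p₁₁, …, p₂₂` are the coordinates of the products of the vectors of a basis `(u, v)`, then
the algebra they define is isomorphic to `c`. -/
theorem ofProducts_mem_orbit {c : StructureConstants ℂ 2} (u v : Fin 2 → ℂ)
    (h : u 0 * v 1 - u 1 * v 0 ≠ 0) {p₁₁ p₁₂ p₂₁ p₂₂ : Fin 2 → ℂ}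
    (h₁₁ : product c u u = p₁₁ 0 • u + p₁₁ 1 • v) (h₁₂ : product c u v = p₁₂ 0 • u + p₁₂ 1 • v)
    (h₂₁ : product c v u = p₂₁ 0 • u + p₂₁ 1 • v) (h₂₂ : product c v v = p₂₂ 0 • u + p₂₂ 1 • v) :
    ofProducts p₁₁ p₁₂ p₂₁ p₂₂ ∈ orbit c := by
  obtain ⟨e, he⟩ := exists_linearEquiv_of_basis h
  refine mem_orbit_symm (mem_orbit_iff.2 ⟨e, fun x y => ?_⟩)
  rw [he x, he y, product_basis, h₁₁, h₁₂, h₂₁, h₂₂, ← he, ← he, ← he, ← he, product_ofProducts]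
  simp only [map_add, map_smul]

/-- The law of `c` in a basis `(u, v)`. -/
theorem exists_mem_orbit_of_basis (c : StructureConstants ℂ 2) {u v : Fin 2 → ℂ}
    (h : u 0 * v 1 - u 1 * v 0 ≠ 0) :
    ∃ d ∈ orbit c, ∃ e : (Fin 2 → ℂ) ≃ₗ[ℂ] (Fin 2 → ℂ), e ![1, 0] = u ∧ e ![0, 1] = v ∧
      ∀ x y, e (product d x y) = product c (e x) (e y) := by
  obtain ⟨e, he⟩ := exists_linearEquiv_of_basis h
  exact ⟨transport e.symm c, transport_mem_orbit _ _, e, by simp [he], by simp [he],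
    fun x y => by simp [product_transport]⟩

/-! ### Classification -/

/-- If the commutator of `e₁` and `e₂` is `e₁`, the Novikov identities leave only the products
`e₁ · e₂ = k e₁`, `e₂ · e₁ = (k - 1) e₁`, `e₂ · e₂ = m e₁ + k e₂`. -/
theorem exists_label_of_commutator {c : StructureConstants ℂ 2} (hc : c ∈ novikovVariety ℂ 2)
    (h : product c ![1, 0] ![0, 1] - product c ![0, 1] ![1, 0] = ![1, 0]) :
    ∃ T : Label, c ∈ orbit (law T) := by
  obtain ⟨a, b, k, l, k', l', m, f, rfl⟩ : ∃ a b k l k' l' m f : ℂ,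
      c = ofProducts ![a, b] ![k, l] ![k', l'] ![m, f] := ⟨_, _, _, _, _, _, _, _, eq_ofProducts c⟩
  obtain rfl : k' = k - 1 := by
    have := congrFun h 0
    simp [product_ofProducts] at this
    linear_combination -this
  obtain rfl : l' = l := by
    have := congrFun h 1
    simp [product_ofProducts] at this
    linear_combination -this
  have hl (z : Fin 2 → ℂ) (i : Fin 2) := congrFun (hc.1 ![1, 0] ![0, 1] z) i
  have hr (x : Fin 2 → ℂ) (i : Fin 2) := congrFun (hc.2 x ![1, 0] ![0, 1]) i
  -- entries of `L₁ = [L₁, L₂]`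
  have l₀₀ : a = k * l' - m * b := by
    have := hl ![1, 0] 0
    simp [product_ofProducts] at this
    linear_combination this
  have l₁₀ : b = b * (k - 1) + l' * l' - l' * a - f * b := by
    have := hl ![1, 0] 1
    simp [product_ofProducts] at this
    linear_combination this
  have l₀₁ : k = a * m + k * f - (k - 1) * k - m * l' := by
    have := hl ![0, 1] 0
    simp [product_ofProducts] at this
    linear_combination this
  have l₁₁ : l' = b * m - l' * k := by
    have := hl ![0, 1] 1
    simp [product_ofProducts] at this
    linear_combination this
  -- entries of `[R₁, R₂] = 0`
  have r₀₀ : (k - 1) * l' - m * b = 0 := by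
    have := hr ![1, 0] 0
    simp [product_ofProducts] at this
    linear_combination -this
  have r₁₀ : b * k + l' * l' - l' * a - f * b = 0 := by
    have := hr ![1, 0] 1
    simp [product_ofProducts] at this
    linear_combination -this
  have r₀₁ : a * m + (k - 1) * f - k * (k - 1) - m * l' = 0 := by
    have := hr ![0, 1] 0
    simp [product_ofProducts] at this
    linear_combination -this
  obtain rfl : a = 0 := by linear_combination l₀₀ + (r₀₀ + l₁₁) / 2
  obtain rfl : l' = 0 := by linear_combination -l₀₀ - r₀₀
  obtain rfl : b = 0 := by linear_combination (l₁₀ + r₁₀) / 2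
  obtain rfl : f = k := by linear_combination -l₀₁ - r₀₁
  rcases eq_or_ne f 1 with rfl | hf
  · rcases eq_or_ne m 0 with rfl | hm
    · refine ⟨.B2 1, mem_orbit_symm (ofProducts_mem_orbit ![1, 0] ![0, 1] (by simp) ?_ ?_ ?_ ?_)⟩ <;>
        simp [product_ofProducts]
    · refine ⟨.B5, mem_orbit_symm (ofProducts_mem_orbit ![m, 0] ![0, 1] (by simpa) ?_ ?_ ?_ ?_)⟩ <;>
        simp [product_ofProducts]
  · have hf' : f - 1 ≠ 0 := sub_ne_zero.2 hf
    refine ⟨.B2 f, mem_orbit_symm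
      (ofProducts_mem_orbit ![1, 0] ![-m / (f - 1), 1] (by simp) ?_ ?_ ?_ ?_)⟩
    · simp [product_ofProducts]
    · simp [product_ofProducts]
    · simp [product_ofProducts]
    · simp [product_ofProducts]
      field_simp
      ring

/-- The algebra `t ℂ[t] / (t² (t - u))`, in the basis `(t², t)`. -/
theorem exists_label_of_double_zero (u : ℂ) :
    ∃ T : Label, ofProducts ![u * u, 0] ![u, 0] ![u, 0] ![1, 0] ∈ orbit (law T) := by
  rcases eq_or_ne u 0 with rfl | hu
  · refine ⟨.A5, mem_orbit_symm (ofProducts_mem_orbit ![1, 0] ![0, 1] (by simp) ?_ ?_ ?_ ?_)⟩ <;>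
      simp [product_ofProducts]
  · -- `t² / u²` is idempotent and annihilates `t - t² / u`
    refine ⟨.A2, mem_orbit_symm
      (ofProducts_mem_orbit ![1 / u ^ 2, 0] ![-1 / u, 1] (by simpa) ?_ ?_ ?_ ?_)⟩
    all_goals
      funext i
      fin_cases i <;> simp [product_ofProducts] <;> field_simp <;> ring

/-- A commutative Novikov algebra with basis `(x · x, x)` is `t ℂ[t] / (t (t - u) (t - v))`, where
`x` is the class of `t` and `u`, `v` are the roots of a quadratic polynomial; the cases are those
of coincidences among `0`, `u` and `v`. -/
theorem exists_label_of_generator {c : StructureConstants ℂ 2} (hc : c ∈ novikovVariety ℂ 2)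
    (hcomm : ∀ x y, product c x y = product c y x) (h : product c ![0, 1] ![0, 1] = ![1, 0]) :
    ∃ T : Label, c ∈ orbit (law T) := by
  obtain ⟨p, q, b, a, b', a', m, f, rfl⟩ : ∃ p q b a b' a' m f : ℂ,
      c = ofProducts ![p, q] ![b, a] ![b', a'] ![m, f] := ⟨_, _, _, _, _, _, _, _, eq_ofProducts c⟩
  obtain ⟨rfl, rfl⟩ : b' = b ∧ a' = a := by
    simpa [product_ofProducts] using hcomm ![0, 1] ![1, 0]
  obtain ⟨rfl, rfl⟩ : m = 1 ∧ f = 0 := by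
    simpa [product_ofProducts] using h
  have hr (i : Fin 2) := congrFun (hc.2 ![0, 1] ![0, 1] ![1, 0]) i
  obtain rfl : p = b' * b' + a' := by
    have := hr 0
    simp [product_ofProducts] at this
    linear_combination this
  obtain rfl : q = b' * a' := by
    have := hr 1
    simp [product_ofProducts] at this
    linear_combination this
  obtain ⟨u, hu⟩ := IsAlgClosed.exists_pow_nat_eq (b' ^ 2 + 4 * a') (n := 2) two_pos
  obtain ⟨u, v, rfl, rfl⟩ : ∃ u v, b' = u + v ∧ a' = -(u * v) :=
    ⟨(b' + u) / 2, (b' - u) / 2, by ring, by linear_combination -hu / 4⟩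
  rcases eq_or_ne v 0 with rfl | hv
  · simpa using exists_label_of_double_zero u
  rcases eq_or_ne u 0 with rfl | hu
  · simpa using exists_label_of_double_zero v
  rcases eq_or_ne u v with rfl | huv
  · -- `2t / u - t² / u²` is the unit and `t² - u t` is nilpotent
    refine ⟨.A4, mem_orbit_symm (ofProducts_mem_orbit ![1, -u] ![-1 / u ^ 2, 2 / u] ?_ ?_ ?_ ?_ ?_)⟩
    · simp; field_simp; norm_num
    all_goals
      funext i
      fin_cases i <;> simp [product_ofProducts] <;> field_simp <;> ring
  · -- the idempotents of `ℂ × ℂ`, as interpolation polynomials at `0`, `u` and `v`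
    have hd : u - v ≠ 0 := sub_ne_zero.2 huv
    refine ⟨.A3, mem_orbit_symm (ofProducts_mem_orbit
      ![1 / (u * (u - v)), -v / (u * (u - v))] ![-1 / (v * (u - v)), u / (v * (u - v))]
        ?_ ?_ ?_ ?_ ?_)⟩
    · have : 1 / (u * (u - v)) * (u / (v * (u - v))) -
          -v / (u * (u - v)) * (-1 / (v * (u - v))) = 1 / (u * v * (u - v)) := by
        field_simp
      change 1 / (u * (u - v)) * (u / (v * (u - v))) -
          -v / (u * (u - v)) * (-1 / (v * (u - v))) ≠ 0
      rw [this]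
      exact one_div_ne_zero (mul_ne_zero (mul_ne_zero hu hv) hd)
    all_goals
      funext i
      fin_cases i <;> simp [product_ofProducts] <;> field_simp <;> ring

/-- A noncommutative Novikov plane has a basis `(w, v)` with commutator `[w, v] = w`. -/
theorem exists_label_of_not_commutative {c : StructureConstants ℂ 2} (hc : c ∈ novikovVariety ℂ 2)
    (hcomm : ¬ ∀ x y, product c x y = product c y x) : ∃ T : Label, c ∈ orbit (law T) := by
  set w := product c ![1, 0] ![0, 1] - product c ![0, 1] ![1, 0] with hw
  have hbracket (x y : Fin 2 → ℂ) :
      product c x y - product c y x = (x 0 * y 1 - x 1 * y 0) • w := by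
    rw [hw, eq_ofProducts c]
    funext i
    fin_cases i <;> (simp [product_ofProducts]; ring)
  have hw0 : w ≠ 0 := fun h => hcomm fun x y => by
    rw [← sub_eq_zero, hbracket, h, smul_zero]
  obtain ⟨v, hv⟩ : ∃ v : Fin 2 → ℂ, w 0 * v 1 - w 1 * v 0 = 1 := by
    rcases eq_or_ne (w 0) 0 with h0 | h0
    · have h1 : w 1 ≠ 0 := fun h1 => hw0 (by
        funext i
        fin_cases i
        · exact h0
        · exact h1)
      exact ⟨![-1 / w 1, 0], by simp; field_simp⟩
    · exact ⟨![0, 1 / w 0], by simp; field_simp⟩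
  obtain ⟨d, hd, e, he₀, he₁, he⟩ := exists_mem_orbit_of_basis c (u := w) (v := v) (by simp [hv])
  have hbr : product d ![1, 0] ![0, 1] - product d ![0, 1] ![1, 0] = ![1, 0] := by
    apply e.injective
    rw [map_sub, he, he, he₀, he₁, hbracket, hv, one_smul]
  obtain ⟨T, hT⟩ := exists_label_of_commutator
    (isClosedInvariant_novikovVariety.orbit_subset c hc hd) hbr
  exact ⟨T, mem_orbit_trans hT (mem_orbit_symm hd)⟩

/-- A commutative associative product on the plane for which `x` and `x · x` are always
proportional is zero: it has the form `x · y = φ(x) y + φ(y) x`, and associativity forces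
`φ = 0`. -/
theorem eq_zero_of_square_proportional {c : StructureConstants ℂ 2} (hc : c ∈ novikovVariety ℂ 2)
    (hcomm : ∀ x y, product c x y = product c y x)
    (h : ∀ x, product c x x 0 * x 1 - product c x x 1 * x 0 = 0) : c = law .A1 := by
  obtain ⟨a, b, k, l, k', l', m, f, rfl⟩ : ∃ a b k l k' l' m f : ℂ,
      c = ofProducts ![a, b] ![k, l] ![k', l'] ![m, f] := ⟨_, _, _, _, _, _, _, _, eq_ofProducts c⟩
  obtain ⟨rfl, rfl⟩ : k' = k ∧ l' = l := by
    simpa [product_ofProducts] using hcomm ![0, 1] ![1, 0]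
  obtain rfl : b = 0 := by simpa [product_ofProducts] using h ![1, 0]
  obtain rfl : m = 0 := by simpa [product_ofProducts] using h ![0, 1]
  have h₁ := h ![1, 1]
  have h₂ := h ![1, -1]
  simp [product_ofProducts] at h₁ h₂
  obtain rfl : a = 2 * l' := by linear_combination (h₁ - h₂) / 2
  obtain rfl : f = 2 * k' := by linear_combination -(h₁ + h₂) / 2
  have hl := congrFun (hc.2 ![1, 0] ![1, 0] ![0, 1]) 1
  have hk := congrFun (hc.2 ![0, 1] ![0, 1] ![1, 0]) 0
  simp [product_ofProducts] at hl hk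
  obtain rfl : l' = 0 := hl.elim (fun h => by linear_combination h) id
  obtain rfl : k' = 0 := hk.elim (fun h => by linear_combination h) id
  funext ⟨i, j, r⟩
  fin_cases i <;> fin_cases j <;> fin_cases r <;> simp [law, ofProducts]

/-- Every two-dimensional complex Novikov algebra is isomorphic to a listed one. -/
theorem exists_label {c : StructureConstants ℂ 2} (hc : c ∈ novikovVariety ℂ 2) :
    ∃ T : Label, c ∈ orbit (law T) := by
  by_cases hcomm : ∀ x y, product c x y = product c y x
  · by_cases hx : ∀ x, product c x x 0 * x 1 - product c x x 1 * x 0 = 0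
    · exact ⟨.A1, eq_zero_of_square_proportional hc hcomm hx ▸ mem_orbit_self _⟩
    · push Not at hx
      obtain ⟨x, hx⟩ := hx
      obtain ⟨d, hd, e, he₀, he₁, he⟩ := exists_mem_orbit_of_basis c hx
      obtain ⟨T, hT⟩ := exists_label_of_generator
        (isClosedInvariant_novikovVariety.orbit_subset c hc hd)
        (isClosedInvariant_commutative.orbit_subset c hcomm hd)
        (e.injective (by rw [he, he₁, he₀]))
      exact ⟨T, mem_orbit_trans hT (mem_orbit_symm hd)⟩
  · exact exists_label_of_not_commutative hc hcomm

/-! ### Conditions satisfied by the orbit closures -/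

theorem trace_left_ofProducts (p q r s x : Fin 2 → ℂ) :
    LinearMap.trace ℂ _ (product (ofProducts p q r s) x) =
      x 0 * p 0 + x 1 * r 0 + x 0 * q 1 + x 1 * s 1 := by
  simp [trace_eq_sum, product_ofProducts, Fin.sum_univ_two]
  ring

theorem trace_right_ofProducts (p q r s x : Fin 2 → ℂ) :
    LinearMap.trace ℂ _ ((product (ofProducts p q r s)).flip x) =
      x 0 * p 0 + x 1 * q 0 + x 0 * r 1 + x 1 * s 1 := by
  simp [trace_eq_sum, product_ofProducts, Fin.sum_univ_two]
  ring

theorem det_right_ofProducts (p q r s x : Fin 2 → ℂ) :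
    LinearMap.det ((product (ofProducts p q r s)).flip x) =
      (x 0 * p 0 + x 1 * q 0) * (x 0 * r 1 + x 1 * s 1) -
        (x 0 * r 0 + x 1 * s 0) * (x 0 * p 1 + x 1 * q 1) := by
  simp [det_eq_of_fin_two, product_ofProducts]

/-- Closed invariant conditions that hold for `law T` and fail for every listed algebra outside
the closure of its orbit. For `A₂` the right multiplications are singular, for `A₄` they have a
double eigenvalue, for `B₂(1)` they are scalar, and for `B₂(β)` and `B₅` the traces of left and
right multiplications are in a fixed ratio. -/
def closedBound : Label → Set (StructureConstants ℂ 2)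
  | .A1 => {c | ∀ x y,
        ((2 : ℕ) : ℂ) • product c x y - LinearMap.trace ℂ _ ((product c).flip y) • x = 0} ∩
      {c | ∀ x, 0 * LinearMap.trace ℂ _ (product c x) -
        1 * LinearMap.trace ℂ _ ((product c).flip x) = 0}
  | .A2 => {c | ∀ x y, product c x y = product c y x} ∩
      {c | ∀ x, 1 * LinearMap.det ((product c).flip x) -
        0 * LinearMap.trace ℂ _ ((product c).flip x) ^ 2 = 0}
  | .A3 => {c | ∀ x y, product c x y = product c y x}
  | .A4 => {c | ∀ x y, product c x y = product c y x} ∩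
      {c | ∀ x, 4 * LinearMap.det ((product c).flip x) -
        1 * LinearMap.trace ℂ _ ((product c).flip x) ^ 2 = 0}
  | .A5 => {c | ∀ x y, product c x y = product c y x} ∩
      {c | ∀ x, 0 * LinearMap.trace ℂ _ (product c x) -
        1 * LinearMap.trace ℂ _ ((product c).flip x) = 0}
  | .B2 β => {c | ∀ x, (2 * β) * LinearMap.trace ℂ _ (product c x) -
        (2 * β - 1) * LinearMap.trace ℂ _ ((product c).flip x) = 0} ∩
      {c | β = 1 → ∀ x y,
        ((2 : ℕ) : ℂ) • product c x y - LinearMap.trace ℂ _ ((product c).flip y) • x = 0}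
  | .B5 => {c | ∀ x, 2 * LinearMap.trace ℂ _ (product c x) -
        1 * LinearMap.trace ℂ _ ((product c).flip x) = 0}

theorem isClosedInvariant_closedBound (T : Label) : IsClosedInvariant (closedBound T) := by
  cases T with
  | A1 => exact isClosedInvariant_scalar_right.inter (isClosedInvariant_trace_relation _ _)
  | A2 => exact isClosedInvariant_commutative.inter (isClosedInvariant_det_relation _ _)
  | A3 => exact isClosedInvariant_commutative
  | A4 => exact isClosedInvariant_commutative.inter (isClosedInvariant_det_relation _ _)
  | A5 => exact isClosedInvariant_commutative.inter (isClosedInvariant_trace_relation _ _)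
  | B2 β =>
    refine (isClosedInvariant_trace_relation _ _).inter ?_
    by_cases h : β = 1
    · simpa [h] using isClosedInvariant_scalar_right (K := ℂ) (n := 2)
    · simpa [h] using
        (⟨fun _ _ => Set.subset_univ _, Set.subset_univ _⟩ :
          IsClosedInvariant (Set.univ : Set (StructureConstants ℂ 2)))
  | B5 => exact isClosedInvariant_trace_relation _ _

theorem law_mem_closedBound (T : Label) : law T ∈ closedBound T := by
  cases T with
  | B2 β =>
    refine ⟨fun x => ?_, ?_⟩
    · simp [law, trace_left_ofProducts, trace_right_ofProducts]
      ring
    · rintro rfl x y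
      funext i
      fin_cases i <;> simp [law, product_ofProducts, trace_right_ofProducts] <;> ring
  | A1 =>
    refine ⟨fun x y => ?_, fun x => ?_⟩ <;> simp [law, product_ofProducts, trace_right_ofProducts]
  | A2 =>
    refine ⟨fun x y => ?_, fun x => ?_⟩ <;>
      simp [law, product_ofProducts, det_right_ofProducts, mul_comm]
  | A3 =>
    intro x y
    simp [law, product_ofProducts, mul_comm]
  | A4 =>
    refine ⟨fun x y => ?_, fun x => ?_⟩
    · funext i
      fin_cases i <;> simp [law, product_ofProducts] <;> ring
    · simp [law, det_right_ofProducts, trace_right_ofProducts]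
      ring
  | A5 =>
    refine ⟨fun x y => ?_, fun x => ?_⟩ <;>
      simp [law, product_ofProducts, trace_right_ofProducts, mul_comm]
  | B5 =>
    intro x
    simp [law, trace_left_ofProducts, trace_right_ofProducts]
    ring

/-- The conditions are evaluated at `e₁`, `e₂` and `e₁ + e₂`, which detects every failure. -/
theorem mem_closureTable_of_law_mem_closedBound {S T : Label} (h : law S ∈ closedBound T) :
    S = T ∨ S ∈ closureTable T := by
  cases T with
  | A1 =>
    have h₁ := h.1 ![0, 1] ![0, 1]
    have h₂ := h.1 ![0, 1] ![1, 0]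
    have h₃ := h.2 ![1, 0]
    have h₄ := h.2 ![0, 1]
    clear h
    revert h₁ h₂ h₃ h₄
    cases S <;> simp [law, product_ofProducts, trace_right_ofProducts, closureTable]
    intro _ h₁ h₀
    exact one_ne_zero (by linear_combination h₀ - h₁ : (1 : ℂ) = 0)
  | A2 =>
    have h₁ := h.1 ![1, 0] ![0, 1]
    have h₂ := h.2 ![0, 1]
    have h₃ := h.2 ![1, 1]
    clear h
    revert h₁ h₂ h₃
    cases S <;> simp [law, product_ofProducts, det_right_ofProducts, closureTable]
    intro h
    exact absurd (by linear_combination h : (1 : ℂ) = 0) one_ne_zero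
  | A3 =>
    have h₁ := h ![1, 0] ![0, 1]
    clear h
    revert h₁
    cases S <;> simp [law, product_ofProducts, closureTable]
    intro h
    exact absurd (by linear_combination h : (1 : ℂ) = 0) one_ne_zero
  | A4 =>
    have h₁ := h.1 ![1, 0] ![0, 1]
    have h₂ := h.2 ![1, 0]
    clear h
    revert h₁ h₂
    cases S <;> simp [law, product_ofProducts, det_right_ofProducts, trace_right_ofProducts,
      closureTable]
    intro h
    exact absurd (by linear_combination h : (1 : ℂ) = 0) one_ne_zero
  | A5 =>
    have h₁ := h.1 ![1, 0] ![0, 1]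
    have h₂ := h.2 ![1, 0]
    have h₃ := h.2 ![0, 1]
    clear h
    revert h₁ h₂ h₃
    cases S <;> simp [law, product_ofProducts, trace_right_ofProducts, closureTable]
    intro h
    exact absurd (by linear_combination h : (1 : ℂ) = 0) one_ne_zero
  | B2 β =>
    have h₁ := h.1 ![1, 0]
    have h₂ := h.1 ![0, 1]
    have h₃ := fun hβ => h.2 hβ ![0, 1] ![0, 1]
    clear h
    revert h₁ h₂ h₃
    cases S <;> simp [law, product_ofProducts, trace_left_ofProducts, trace_right_ofProducts,
      closureTable]
    · intro h
      exact absurd (by linear_combination h / 2 : (1 : ℂ) = 0) one_ne_zero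
    · intro h _
      linear_combination h / 2
    · intro h
      linear_combination -h / 2
  | B5 =>
    have h₁ := h ![1, 0]
    have h₂ := h ![0, 1]
    clear h
    revert h₁ h₂
    cases S <;> simp [law, trace_left_ofProducts, trace_right_ofProducts,
      closureTable]
    · norm_num
    · norm_num
    · norm_num
    · intro h
      linear_combination h / 2

/-! ### Degenerations -/

theorem continuous_product {n : ℕ} (x y : Fin n → ℂ) :
    Continuous fun c : StructureConstants ℂ n => product c x y := by
  change Continuous fun (c : StructureConstants ℂ n) k => ∑ i, ∑ j, c (i, j, k) * (x i * y j)
  fun_prop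

theorem continuous_transport {n : ℕ} (e : (Fin n → ℂ) ≃ₗ[ℂ] (Fin n → ℂ)) :
    Continuous (transport e) := by
  refine continuous_pi fun s => ?_
  have h := (LinearMap.continuous_of_finiteDimensional e.toLinearMap).comp
    (continuous_product (e.symm (Pi.single s.1 1)) (e.symm (Pi.single s.2.1 1)))
  exact (continuous_apply s.2.2).comp h

/-- The closure in the usual topology is contained in the Zariski closure. -/
theorem closure_subset_zariskiClosure {n : ℕ} (S : Set (StructureConstants ℂ n)) :
    closure S ⊆ zariskiClosure S := by
  intro c hc p hp
  have : IsClosed {d : StructureConstants ℂ n | MvPolynomial.aeval d p = 0} := by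
    simp only [MvPolynomial.aeval_eq_eval]
    exact isClosed_eq (MvPolynomial.continuous_eval p) continuous_const
  exact closure_minimal (fun d hd => hp d hd) this hc

/-- A curve whose points for `t ≠ 0` lie in the orbit of `c` ends in the Zariski closure of that
orbit, together with the orbit of its end point. -/
theorem orbit_subset_zariskiClosure_of_curve {n : ℕ} {c : StructureConstants ℂ n}
    {γ : ℂ → StructureConstants ℂ n} (hγ : Continuous γ) (h : ∀ t ≠ 0, γ t ∈ orbit c) :
    orbit (γ 0) ⊆ zariskiClosure (orbit c) := by
  intro d hd
  obtain ⟨e, he⟩ := mem_orbit_iff.1 hd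
  have hd' : transport e (γ 0) = d := product_injective <| by
    refine LinearMap.ext fun x => LinearMap.ext fun y => ?_
    simp [product_transport, he]
  have h0 : (0 : ℂ) ∈ closure {0}ᶜ := by simp
  rw [← hd']
  have hcont : Continuous fun t => transport e (γ t) := (continuous_transport e).comp hγ
  have hmaps : Set.MapsTo (fun t => transport e (γ t)) {0}ᶜ (orbit c) :=
    fun t ht => mem_orbit_trans (h t ht) (transport_mem_orbit _ _)
  exact closure_subset_zariskiClosure _ (map_mem_closure (f := fun t => transport e (γ t)) hcont h0 hmaps)

/-- A degeneration given by a family of bases `(u t, v t)` for `t ≠ 0`, in which the products have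
coordinates `p t`, `q t`, `r t`, `s t` that extend continuously to `t = 0`. -/
theorem orbit_subset_zariskiClosure_of_bases {c d : StructureConstants ℂ 2}
    (u v p q r s : ℂ → Fin 2 → ℂ) (hd : d = ofProducts (p 0) (q 0) (r 0) (s 0)) (hp : Continuous p) (hq : Continuous q) (hr : Continuous r)
    (hs : Continuous s) (hdet : ∀ t ≠ 0, u t 0 * v t 1 - u t 1 * v t 0 ≠ 0)
    (h₁₁ : ∀ t ≠ 0, product c (u t) (u t) = p t 0 • u t + p t 1 • v t)
    (h₁₂ : ∀ t ≠ 0, product c (u t) (v t) = q t 0 • u t + q t 1 • v t)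
    (h₂₁ : ∀ t ≠ 0, product c (v t) (u t) = r t 0 • u t + r t 1 • v t)
    (h₂₂ : ∀ t ≠ 0, product c (v t) (v t) = s t 0 • u t + s t 1 • v t) :
    orbit d ⊆ zariskiClosure (orbit c) := by
  rw [hd]
  refine orbit_subset_zariskiClosure_of_curve
    (γ := fun t => ofProducts (p t) (q t) (r t) (s t)) (continuous_pi fun ⟨i, j, k⟩ => ?_)
    fun t ht => ofProducts_mem_orbit (u t) (v t) (hdet t ht) (h₁₁ t ht) (h₁₂ t ht) (h₂₁ t ht)
      (h₂₂ t ht)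
  fin_cases i <;> fin_cases j <;> simp only [ofProducts] <;>
    exact (continuous_apply k).comp ‹_›

/-- Every algebra degenerates to the zero product, through the isomorphic products `t • c`. -/
theorem orbit_zero_subset (c : StructureConstants ℂ 2) :
    orbit (law .A1) ⊆ zariskiClosure (orbit c) := by
  have h : ∀ t : ℂ, t ≠ 0 → t • c ∈ orbit c := fun t ht => by
    refine mem_orbit_iff.2
      ⟨LinearEquiv.smulOfNeZero ℂ (Fin 2 → ℂ) t⁻¹ (inv_ne_zero ht), fun x y => ?_⟩
    have hs : product (t • c) = t • product c := by
      refine LinearMap.ext fun x => LinearMap.ext fun y => funext fun k => ?_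
      simp [product]
      ring
    simp [hs, smul_smul, ht]
  convert orbit_subset_zariskiClosure_of_curve (γ := fun t => t • c) (by fun_prop) h
  funext ⟨i, j, k⟩
  fin_cases i <;> fin_cases j <;> simp [law, ofProducts]

theorem cons_zero_zero : (![0, 0] : Fin 2 → ℂ) = 0 := by
  funext i
  fin_cases i <;> rfl

/-- Each degeneration to a nonzero algebra `S` is given by a basis `(u t, v t)` of `law T` in which
the products tend to those of `law S`. Where `S = A₅`, the vector `u t` is the part of
`v t · v t` that remains after subtracting a multiple of `v t` that vanishes at `t = 0`. -/
theorem orbit_subset_zariskiClosure_of_mem_closureTable {T S : Label} (h : S ∈ closureTable T) :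
    orbit (law S) ⊆ zariskiClosure (orbit (law T)) := by
  rcases eq_or_ne S .A1 with rfl | hS
  · exact orbit_zero_subset _
  cases T with
  | A1 => exact h.elim
  | A2 =>
    obtain rfl : S = .A5 := by simpa [closureTable, hS] using h
    refine orbit_subset_zariskiClosure_of_bases (fun t => ![t ^ 2, 0]) (fun t => ![t, 1])
      (fun t => ![t ^ 2, 0]) (fun t => ![t, 0]) (fun t => ![t, 0]) (fun t => ![1, 0])
      (by simp [law, cons_zero_zero]) (by fun_prop) (by fun_prop) (by fun_prop) (by fun_prop)
      ?_ ?_ ?_ ?_ ?_ <;> intro t ht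
    · simp [ht]
    all_goals
      funext i
      fin_cases i <;> simp [law, product_ofProducts] <;> field_simp
  | A3 =>
    obtain rfl | rfl | rfl : S = .A2 ∨ S = .A4 ∨ S = .A5 := by simpa [closureTable, hS] using h
    · refine orbit_subset_zariskiClosure_of_bases (fun t => ![1, 0]) (fun t => ![0, t])
        (fun t => ![1, 0]) (fun t => ![0, 0]) (fun t => ![0, 0]) (fun t => ![0, t])
        (by simp [law, cons_zero_zero]) (by fun_prop) (by fun_prop) (by fun_prop) (by fun_prop)
        ?_ ?_ ?_ ?_ ?_ <;> intro t ht
      · simp [ht]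
      all_goals
        funext i
        fin_cases i <;> simp [law, product_ofProducts]
    · refine orbit_subset_zariskiClosure_of_bases (fun t => ![t, 0]) (fun t => ![1, 1])
        (fun t => ![t, 0]) (fun t => ![1, 0]) (fun t => ![1, 0]) (fun t => ![0, 1])
        (by simp [law, cons_zero_zero]) (by fun_prop) (by fun_prop) (by fun_prop) (by fun_prop)
        ?_ ?_ ?_ ?_ ?_ <;> intro t ht
      · simp [ht]
      all_goals
        funext i
        fin_cases i <;> simp [law, product_ofProducts]
    · refine orbit_subset_zariskiClosure_of_bases (fun t => ![t ^ 2, 4 * t ^ 2]) (fun t => ![t, 2 * t])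
        (fun t => ![7 * t ^ 2, -6 * t ^ 3]) (fun t => ![3 * t, -2 * t ^ 2]) (fun t => ![3 * t, -2 * t ^ 2]) (fun t => ![1, 0])
        (by simp [law, cons_zero_zero]) (by fun_prop) (by fun_prop) (by fun_prop) (by fun_prop)
        ?_ ?_ ?_ ?_ ?_ <;> intro t ht
      · change t ^ 2 * (2 * t) - 4 * t ^ 2 * t ≠ 0
        rw [show t ^ 2 * (2 * t) - 4 * t ^ 2 * t = -2 * t ^ 3 by ring]
        simp [ht]
      all_goals
        funext i
        fin_cases i <;> simp [law, product_ofProducts] <;> field_simp <;> ring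
  | A4 =>
    obtain rfl : S = .A5 := by simpa [closureTable, hS] using h
    refine orbit_subset_zariskiClosure_of_bases (fun t => ![t, 0]) (fun t => ![1, t])
      (fun t => ![0, 0]) (fun t => ![t, 0]) (fun t => ![t, 0]) (fun t => ![1, t])
      (by simp [law, cons_zero_zero]) (by fun_prop) (by fun_prop) (by fun_prop) (by fun_prop)
      ?_ ?_ ?_ ?_ ?_ <;> intro t ht
    · simp [ht]
    all_goals
      funext i
      fin_cases i <;> simp [law, product_ofProducts]
  | A5 => exact absurd h hS
  | B2 β =>
    obtain ⟨hβ, rfl⟩ : β ≠ 1 ∧ S = .A5 := by simpa [closureTable, hS] using h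
    have hβ' : β - 1 ≠ 0 := sub_ne_zero.2 hβ
    refine orbit_subset_zariskiClosure_of_bases (fun t => ![t * (β - 1), 0]) (fun t => ![1, t])
      (fun t => ![0, 0]) (fun t => ![β * t, 0]) (fun t => ![(β - 1) * t, 0]) (fun t => ![1, β * t])
      (by simp [law, cons_zero_zero]) (by fun_prop) (by fun_prop) (by fun_prop) (by fun_prop)
      ?_ ?_ ?_ ?_ ?_ <;> intro t ht
    · simp [ht, hβ']
    all_goals
      funext i
      fin_cases i <;> simp [law, product_ofProducts] <;> field_simp <;> ring
  | B5 =>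
    obtain rfl | rfl : S = .A5 ∨ S = .B2 1 := by simpa [closureTable, hS] using h
    · refine orbit_subset_zariskiClosure_of_bases (fun t => ![t ^ 2, 0]) (fun t => ![0, t])
        (fun t => ![0, 0]) (fun t => ![t, 0]) (fun t => ![0, 0]) (fun t => ![1, t])
        (by simp [law, cons_zero_zero]) (by fun_prop) (by fun_prop) (by fun_prop) (by fun_prop)
        ?_ ?_ ?_ ?_ ?_ <;> intro t ht
      · simp [ht]
      all_goals
        funext i
        fin_cases i <;> simp [law, product_ofProducts] <;> field_simp
    · refine orbit_subset_zariskiClosure_of_bases (fun t => ![t⁻¹, 0]) (fun t => ![0, 1])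
        (fun t => ![0, 0]) (fun t => ![1, 0]) (fun t => ![0, 0]) (fun t => ![t, 1])
        (by simp [law, cons_zero_zero]) (by fun_prop) (by fun_prop) (by fun_prop) (by fun_prop)
        ?_ ?_ ?_ ?_ ?_ <;> intro t ht
      · simp [ht]
      all_goals
        funext i
        fin_cases i <;> simp [law, product_ofProducts] <;> field_simp

/-! ### Orbit closures and the Hasse diagram -/

theorem law_mem_novikovVariety (T : Label) : law T ∈ novikovVariety ℂ 2 := by
  constructor
  · intro x y z
    funext i
    cases T <;> fin_cases i <;> simp [law, product_ofProducts]
    all_goals ring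
  · intro x y z
    funext i
    cases T <;> fin_cases i <;> simp [law, product_ofProducts]
    all_goals first | ring1 | exact Or.inl (by ring)

theorem zariskiClosure_orbit_subset_novikovVariety (T : Label) :
    zariskiClosure (orbit (law T)) ⊆ novikovVariety ℂ 2 :=
  isClosedInvariant_novikovVariety.zariskiClosure_orbit_subset (law_mem_novikovVariety T)

/-- Orbit closures contain no orbits besides those in the table. -/
theorem eq_or_mem_closureTable {T S : Label} {c : StructureConstants ℂ 2}
    (hS : c ∈ orbit (law S)) (hT : c ∈ zariskiClosure (orbit (law T))) :
    S = T ∨ S ∈ closureTable T :=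
  mem_closureTable_of_law_mem_closedBound <|
    (isClosedInvariant_closedBound T).orbit_subset c
      ((isClosedInvariant_closedBound T).zariskiClosure_orbit_subset (law_mem_closedBound T) hT)
      (mem_orbit_symm hS)

theorem subset_zariskiClosure {n : ℕ} (S : Set (StructureConstants ℂ n)) : S ⊆ zariskiClosure S :=
  subset_closure.trans (closure_subset_zariskiClosure S)

theorem closureTable_asymm {T S : Label} (h₁ : S ∈ closureTable T) (h₂ : T ∈ closureTable S) :
    False := by
  cases T <;> cases S <;> simp_all [closureTable]

/-- Two listed algebras in one orbit lie in each other's orbit closure, and the table is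
antisymmetric. -/
theorem label_unique {T S : Label} {c : StructureConstants ℂ 2}
    (hT : c ∈ orbit (law T)) (hS : c ∈ orbit (law S)) : S = T := by
  rcases eq_or_mem_closureTable hS (subset_zariskiClosure _ hT) with h | h
  · exact h
  rcases eq_or_mem_closureTable hT (subset_zariskiClosure _ hS) with h' | h'
  · exact h'.symm
  · exact (closureTable_asymm h h').elim

theorem zariskiClosure_orbit_law (T : Label) :
    zariskiClosure (orbit (law T)) =
      orbit (law T) ∪ ⋃ S ∈ closureTable T, orbit (law S) := by
  apply Set.Subset.antisymm
  · intro c hc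
    obtain ⟨S, hS⟩ := exists_label (zariskiClosure_orbit_subset_novikovVariety T hc)
    rcases eq_or_mem_closureTable hS hc with rfl | h
    · exact Or.inl hS
    · exact Or.inr (Set.mem_biUnion h hS)
  · exact Set.union_subset (subset_zariskiClosure _)
      (Set.iUnion₂_subset fun S hS => orbit_subset_zariskiClosure_of_mem_closureTable hS)

theorem orbitClosureIn_law {X : Set (StructureConstants ℂ 2)} (hX : novikovVariety ℂ 2 ⊆ X)
    (T : Label) : orbitClosureIn X (law T) =
      orbit (law T) ∪ ⋃ S ∈ closureTable T, orbit (law S) := by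
  rw [← zariskiClosure_orbit_law]
  exact Set.inter_eq_right.2 ((zariskiClosure_orbit_subset_novikovVariety T).trans hX)

theorem properlyDegenerates_iff {T S : Label} :
    ProperlyDegenerates (law T) (law S) ↔ S ∈ closureTable T := by
  rw [ProperlyDegenerates, orbitClosureIn_law fun c hc => hc.1]
  constructor
  · rintro ⟨h | h, h'⟩
    · exact (h' h).elim
    · obtain ⟨U, hU, h⟩ := Set.mem_iUnion₂.1 h
      rwa [label_unique h (mem_orbit_self _)]
  · intro h
    refine ⟨Or.inr (Set.mem_biUnion h (mem_orbit_self _)), fun h' => ?_⟩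
    obtain rfl := label_unique h' (mem_orbit_self _)
    exact closureTable_asymm h h

theorem hasseArrow_iff {T S : Label} :
    HasseArrow T S ↔ S ∈ closureTable T ∧ ¬ ∃ U, U ∈ closureTable T ∧ S ∈ closureTable U := by
  constructor
  · intro h
    cases h <;> refine ⟨by simp_all [closureTable], ?_⟩ <;> rintro ⟨U, hU, hS⟩ <;>
      cases U <;> simp_all [closureTable]
  · rintro ⟨h, hU⟩
    cases T <;> cases S <;> simp [closureTable] at h
    · exact (hU ⟨.A5, by simp [closureTable]⟩).elim
    · exact .A2_A5
    · exact (hU ⟨.A5, by simp [closureTable]⟩).elim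
    · exact .A3_A2
    · exact .A3_A4
    · exact (hU ⟨.A2, by simp [closureTable]⟩).elim
    · exact (hU ⟨.A5, by simp [closureTable]⟩).elim
    · exact .A4_A5
    · exact .A5_A1
    · rename_i β
      rcases eq_or_ne β 1 with rfl | hβ
      · exact .B2_A1
      · exact (hU ⟨.A5, by simp [closureTable, hβ]⟩).elim
    · exact .B2_A5 _ h
    · exact (hU ⟨.A5, by simp [closureTable]⟩).elim
    · exact .B5_A5
    · exact h ▸ .B5_B2

/-! ### Derivations -/

/-- Leibniz's rule on the products of basis vectors, for the derivation with matrix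
`!![α, β; γ, δ]`. -/
theorem mem_derivations_iff (p q r s : Fin 2 → ℂ) (α β γ δ : ℂ) :
    Matrix.toLin' !![α, β; γ, δ] ∈ derivations (ofProducts p q r s) ↔
      (β * p 1 = α * p 0 + γ * (q 0 + r 0) ∧
        γ * p 0 + δ * p 1 = 2 * α * p 1 + γ * (q 1 + r 1)) ∧
      (β * q 1 = γ * s 0 + β * p 0 + δ * q 0 ∧ γ * q 0 = γ * s 1 + β * p 1 + α * q 1) ∧
      (β * r 1 = γ * s 0 + β * p 0 + δ * r 0 ∧ γ * r 0 = γ * s 1 + β * p 1 + α * r 1) ∧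
      (α * s 0 + β * s 1 = 2 * δ * s 0 + β * (q 0 + r 0) ∧
        γ * s 0 = δ * s 1 + β * (q 1 + r 1)) := by
  have hM (x : Fin 2 → ℂ) : Matrix.toLin' !![α, β; γ, δ] x =
      ![α * x 0 + β * x 1, γ * x 0 + δ * x 1] := by
    funext i
    fin_cases i <;> simp [Matrix.toLin'_apply, Matrix.mulVec, dotProduct, Fin.sum_univ_two]
  change (∀ x y, _ = _) ↔ _
  simp only [hM, product_ofProducts]
  constructor
  · intro h
    have h₀ (x y : Fin 2 → ℂ) := congrFun (h x y) 0
    have h₁ (x y : Fin 2 → ℂ) := congrFun (h x y) 1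
    simp at h₀ h₁
    have e₁ := h₀ ![1, 0] ![1, 0]
    have e₂ := h₁ ![1, 0] ![1, 0]
    have e₃ := h₀ ![1, 0] ![0, 1]
    have e₄ := h₁ ![1, 0] ![0, 1]
    have e₅ := h₀ ![0, 1] ![1, 0]
    have e₆ := h₁ ![0, 1] ![1, 0]
    have e₇ := h₀ ![0, 1] ![0, 1]
    have e₈ := h₁ ![0, 1] ![0, 1]
    simp at e₁ e₂ e₃ e₄ e₅ e₆ e₇ e₈
    refine ⟨⟨?_, ?_⟩, ⟨?_, ?_⟩, ⟨?_, ?_⟩, ?_, ?_⟩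
    · linear_combination e₁
    · linear_combination e₂
    · linear_combination e₃
    · linear_combination e₄
    · linear_combination e₅
    · linear_combination e₆
    · linear_combination e₇
    · linear_combination e₈
  · rintro ⟨⟨e₁, e₂⟩, ⟨e₃, e₄⟩, ⟨e₅, e₆⟩, e₇, e₈⟩ x y
    funext i
    fin_cases i
    · simp
      linear_combination x 0 * y 0 * e₁ + x 0 * y 1 * e₃ + x 1 * y 0 * e₅ + x 1 * y 1 * e₇
    · simp
      linear_combination x 0 * y 0 * e₂ + x 0 * y 1 * e₄ + x 1 * y 0 * e₆ + x 1 * y 1 * e₈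

/-- The dimension of the derivation algebra, from a basis of it consisting of matrices. -/
theorem finrank_derivations {k : ℕ} {c : StructureConstants ℂ 2}
    (v : Fin k → Matrix (Fin 2) (Fin 2) ℂ) (hv : LinearIndependent ℂ v)
    (h : ∀ α β γ δ : ℂ, Matrix.toLin' !![α, β; γ, δ] ∈ derivations c ↔
      ∃ a : Fin k → ℂ, ∑ i, a i • v i = !![α, β; γ, δ]) :
    Module.finrank ℂ (derivations c) = k := by
  have hspan : derivations c = (Submodule.span ℂ (Set.range v)).map
      (Matrix.toLin' : Matrix (Fin 2) (Fin 2) ℂ ≃ₗ[ℂ] _).toLinearMap := by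
    ext D
    rw [Submodule.mem_map]
    obtain ⟨M, rfl⟩ := Matrix.toLin'.surjective D
    rw [M.eta_fin_two, h, ← Submodule.mem_span_range_iff_exists_fun]
    constructor
    · exact fun hM => ⟨_, hM, rfl⟩
    · rintro ⟨N, hN, hNM⟩
      rwa [← Matrix.toLin'.injective hNM]
  rw [hspan, LinearEquiv.finrank_map_eq, finrank_span_eq_card hv, Fintype.card_fin]

theorem exists_apply_zero_eq (z : ℂ) : ∃ x : Fin 1 → ℂ, x 0 = z :=
  ⟨fun _ => z, rfl⟩

theorem finrank_derivations_A1 : Module.finrank ℂ (derivations (law .A1)) = 4 := by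
  have h : derivations (law .A1) = ⊤ := by
    refine eq_top_iff.2 fun D _ x y => ?_
    simp [law, product_ofProducts]
  rw [h, finrank_top, Module.finrank_linearMap]
  simp

theorem finrank_derivations_A3 : Module.finrank ℂ (derivations (law .A3)) = 0 := by
  refine finrank_derivations ![] linearIndependent_empty_type fun α β γ δ => ?_
  rw [law, mem_derivations_iff]
  simp [← Matrix.ext_iff, Fin.forall_fin_two]
  grind

theorem finrank_derivations_A2 : Module.finrank ℂ (derivations (law .A2)) = 1 := by
  refine finrank_derivations ![!![0, 0; 0, 1]] ?_ fun α β γ δ => ?_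
  · simp [← Matrix.ext_iff]
  rw [law, mem_derivations_iff]
  simp [exists_apply_zero_eq]
  grind

theorem finrank_derivations_A4 : Module.finrank ℂ (derivations (law .A4)) = 1 := by
  refine finrank_derivations ![!![1, 0; 0, 0]] ?_ fun α β γ δ => ?_
  · simp [← Matrix.ext_iff]
  rw [law, mem_derivations_iff]
  simp [exists_apply_zero_eq]
  grind

theorem finrank_derivations_B2 {β : ℂ} (hβ : β ≠ 1) :
    Module.finrank ℂ (derivations (law (.B2 β))) = 1 := by
  refine finrank_derivations ![!![1, 0; 0, 0]] ?_ fun α b γ δ => ?_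
  · simp [← Matrix.ext_iff]
  rw [law, mem_derivations_iff]
  simp [exists_apply_zero_eq]
  grind

theorem finrank_derivations_B5 : Module.finrank ℂ (derivations (law .B5)) = 1 := by
  refine finrank_derivations ![!![0, 1; 0, 0]] ?_ fun α β γ δ => ?_
  · simp [← Matrix.ext_iff]
  rw [law, mem_derivations_iff]
  simp [exists_apply_zero_eq]
  grind

theorem finrank_derivations_A5 : Module.finrank ℂ (derivations (law .A5)) = 2 := by
  refine finrank_derivations ![!![2, 0; 0, 1], !![0, 1; 0, 0]] ?_ fun α β γ δ => ?_
  · simp [LinearIndependent.pair_iff, ← Matrix.ext_iff, Fin.forall_fin_two]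
  rw [law, mem_derivations_iff]
  simp
  constructor
  · rintro ⟨hγ, hα, -⟩
    exact ⟨![δ, β], by simp [hα, mul_comm], hγ, by simp⟩
  · grind

theorem finrank_derivations_B2_one : Module.finrank ℂ (derivations (law (.B2 1))) = 2 := by
  refine finrank_derivations ![!![1, 0; 0, 0], !![0, 1; 0, 0]] ?_ fun α β γ δ => ?_
  · simp [LinearIndependent.pair_iff, ← Matrix.ext_iff, Fin.forall_fin_two]
  rw [law, mem_derivations_iff]
  simp
  constructor
  · rintro ⟨hγ, hδ, -⟩
    exact ⟨⟨![α, β], by simp, by simp⟩, hγ, hδ⟩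
  · grind

end NovikovDegeneration

theorem mainTheorem2 :
    -- the vertices: the listed algebras are Novikov, and every two-dimensional complex Novikov
    -- structure lies in the orbit of exactly one of them
    (∀ T : NovikovDegeneration.Label,
      NovikovDegeneration.law T ∈ NovikovDegeneration.novikovVariety ℂ 2) ∧
    (∀ c ∈ NovikovDegeneration.novikovVariety ℂ 2,
      ∃! T : NovikovDegeneration.Label,
        c ∈ NovikovDegeneration.orbit (NovikovDegeneration.law T)) ∧
    -- the orbit closures, in the Novikov variety and in the variety of pre-Lie structures
    (∀ T : NovikovDegeneration.Label,
      NovikovDegeneration.orbitClosureIn (NovikovDegeneration.novikovVariety ℂ 2)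
          (NovikovDegeneration.law T) =
        NovikovDegeneration.orbit (NovikovDegeneration.law T) ∪
          ⋃ S ∈ NovikovDegeneration.closureTable T,
            NovikovDegeneration.orbit (NovikovDegeneration.law S)) ∧
    (∀ T : NovikovDegeneration.Label,
      NovikovDegeneration.orbitClosureIn (NovikovDegeneration.preLieVariety ℂ 2)
          (NovikovDegeneration.law T) =
        NovikovDegeneration.orbit (NovikovDegeneration.law T) ∪
          ⋃ S ∈ NovikovDegeneration.closureTable T,
            NovikovDegeneration.orbit (NovikovDegeneration.law S)) ∧
    -- the proper degenerations between the listed algebras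
    (∀ T S : NovikovDegeneration.Label,
      NovikovDegeneration.ProperlyDegenerates
          (NovikovDegeneration.law T) (NovikovDegeneration.law S) ↔
        S ∈ NovikovDegeneration.closureTable T) ∧
    -- the arrows of the diagram: the proper degenerations with no algebra strictly between
    (∀ T S : NovikovDegeneration.Label,
      NovikovDegeneration.HasseArrow T S ↔
        NovikovDegeneration.ProperlyDegenerates
            (NovikovDegeneration.law T) (NovikovDegeneration.law S) ∧
          ¬ ∃ U : NovikovDegeneration.Label,
            NovikovDegeneration.ProperlyDegenerates
                (NovikovDegeneration.law T) (NovikovDegeneration.law U) ∧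
              NovikovDegeneration.ProperlyDegenerates
                (NovikovDegeneration.law U) (NovikovDegeneration.law S)) ∧
    -- the rows of the diagram, by the dimension of the derivation algebra
    Module.finrank ℂ (NovikovDegeneration.derivations
      (NovikovDegeneration.law .A3)) = 0 ∧
    (Module.finrank ℂ (NovikovDegeneration.derivations
        (NovikovDegeneration.law .A2)) = 1 ∧
      Module.finrank ℂ (NovikovDegeneration.derivations
        (NovikovDegeneration.law .A4)) = 1 ∧
      (∀ β : ℂ, β ≠ 1 → Module.finrank ℂ (NovikovDegeneration.derivations
        (NovikovDegeneration.law (.B2 β))) = 1) ∧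
      Module.finrank ℂ (NovikovDegeneration.derivations
        (NovikovDegeneration.law .B5)) = 1) ∧
    (Module.finrank ℂ (NovikovDegeneration.derivations
        (NovikovDegeneration.law .A5)) = 2 ∧
      Module.finrank ℂ (NovikovDegeneration.derivations
        (NovikovDegeneration.law (.B2 1))) = 2) ∧
    Module.finrank ℂ (NovikovDegeneration.derivations
      (NovikovDegeneration.law .A1)) = 4 :=
  ⟨NovikovDegeneration.law_mem_novikovVariety,
    fun _ hc =>
      let ⟨T, hT⟩ := NovikovDegeneration.exists_label hc
      ⟨T, hT, fun _ hS => NovikovDegeneration.label_unique hT hS⟩,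
    NovikovDegeneration.orbitClosureIn_law subset_rfl,
    NovikovDegeneration.orbitClosureIn_law fun _ hc => hc.1,
    fun _ _ => NovikovDegeneration.properlyDegenerates_iff,
    fun T S => by
      simp only [NovikovDegeneration.properlyDegenerates_iff]
      exact NovikovDegeneration.hasseArrow_iff,
    NovikovDegeneration.finrank_derivations_A3,
    ⟨NovikovDegeneration.finrank_derivations_A2, NovikovDegeneration.finrank_derivations_A4,
      fun _ => NovikovDegeneration.finrank_derivations_B2,
      NovikovDegeneration.finrank_derivations_B5⟩,
    ⟨NovikovDegeneration.finrank_derivations_A5, NovikovDegeneration.finrank_derivations_B2_one⟩,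
    NovikovDegeneration.finrank_derivations_A1⟩
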